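/- Let $X$ be a separable real Hilbert space (possibly infinite dimensional) with norm $|\cdot|$ and scalar product $\langle\cdot,\cdot\rangle$, and let $TX = X\times X$, with points $(x,v)$, be its tangent bundle. Let $\mathcal P_2(X)$ be the set of Borel probability measures $\mu$ on $X$ with $\int|x|^2\,d\mu<\infty$, and $\mathcal P_2(TX)$ the set of Borel probability measures $\Phi$ on $TX$ with $\int(|x|^2+|v|^2)\,d\Phi(x,v)<\infty$. Write $\Gamma(\mu,\nu)$ for the set of couplings of $\mu$ and $\nu$, i.e. probability measures on the product space with marginals $\mu$ and $\nu$. For $\mu,\nu\in\mathcal P_2(X)$ let $W_2^2(\mu,\nu)=\inf_{\gamma\in\Gamma(\mu,\nu)}\int|x-y|^2\,d\gamma(x,y)$, and let $\Gamma_o(\mu,\nu)$ be the set of $\gamma\in\Gamma(\mu,\nu)$ that realise this infimum. Put $\mathsf x(x,v)=x$ and $\exp^s(x,v)=x+sv$ for $s\in\mathbb R$, and write $f_\sharp$ for the push-forward of measures under $f$. For $\Phi_0,\Phi_1\in\mathcal P_2(TX)$ and $\mu_1\in\mathcal P_2(X)$ define $$[\Phi_0,\mu_1]_r=\lim_{s\downarrow0}\frac{W_2^2(\exp^s_\sharp\Phi_0,\mu_1)-W_2^2(\mathsf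 x_\sharp\Phi_0,\mu_1)}{2s},\qquad [\Phi_0,\Phi_1]_r=\lim_{s\downarrow0}\frac{W_2^2(\exp^s_\sharp\Phi_0,\exp^s_\sharp\Phi_1)-W_2^2(\mathsf x_\sharp\Phi_0,\mathsf x_\sharp\Phi_1)}{2s},$$ $$\Lambda(\Phi_0,\mu_1)=\{\sigma\in\Gamma(\Phi_0,\mu_1): (x_0,x_1)_\sharp\sigma\in\Gamma_o(\mathsf x_\sharp\Phi_0,\mu_1)\},$$ $$\Lambda(\Phi_0,\Phi_1)=\{\Theta\in\Gamma(\Phi_0,\Phi_1): (x_0,x_1)_\sharp\Theta\in\Gamma_o(\mathsf x_\sharp\Phi_0,\mathsf x_\sharp\Phi_1)\},$$ where $(x_0,v_0,x_1)$ denotes a point of $TX\times X$, $(x_0,v_0,x_1,v_1)$ a point of $TX\times TX$, and $(x_0,x_1)$ the corresponding projection onto $X\times X$. Theorem. For all $\Phi_0,\Phi_1\in\mathcal P_2(TX)$ and $\mu_1\in\mathcal P_2(X)$ both limits exist in $\mathbb R$, the integrands below are integrable with respect to every element of $\Lambda(\Phi_0,\mu_1)$, respectively $\Lambda(\Phi_0,\Phi_1)$,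 and $$[\Phi_0,\mu_1]_r=\min\Big\{\int_{TX\times X}\langle x_0-x_1,v_0\rangle\,d\sigma : \sigma\in\Lambda(\Phi_0,\mu_1)\Big\},$$ $$[\Phi_0,\Phi_1]_r=\min\Big\{\int_{TX\times TX}\langle x_0-x_1,v_0-v_1\rangle\,d\Theta : \Theta\in\Lambda(\Phi_0,\Phi_1)\Big\},$$ where both minima are attained (in particular both sets $\Lambda$ are non-empty). -/

import Mathlib

open MeasureTheory Filter Topology
open scoped ENNReal

namespace WassersteinPairing

noncomputable section

/-- The admissible couplings `Γ(μ, ν)`: probability measures with marginals `μ` and `ν`. -/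
def couplings {A B : Type*} [MeasurableSpace A] [MeasurableSpace B]
    (μ : Measure A) (ν : Measure B) : Set (Measure (A × B)) :=
  {γ | IsProbabilityMeasure γ ∧ γ.map Prod.fst = μ ∧ γ.map Prod.snd = ν}

variable {X : Type*} [NormedAddCommGroup X] [InnerProductSpace ℝ X] [MeasurableSpace X]

/-- `P₂(X)`: probability measures on `X` with finite second moment. -/
def P2 (X : Type*) [NormedAddCommGroup X] [MeasurableSpace X] : Set (Measure X) :=
  {μ | IsProbabilityMeasure μ ∧ ∫⁻ x, ‖x‖ₑ ^ 2 ∂μ < ∞}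

/-- `P₂(TX)`: probability measures `Φ` on the tangent bundle `TX = X × X` such that
`∫ (|x|² + |v|²) dΦ(x, v)` is finite. -/
def P2T (X : Type*) [NormedAddCommGroup X] [MeasurableSpace X] : Set (Measure (X × X)) :=
  {Φ | IsProbabilityMeasure Φ ∧ ∫⁻ p, (‖p.1‖ₑ ^ 2 + ‖p.2‖ₑ ^ 2) ∂Φ < ∞}

/-- The quadratic transport cost `∫ |x - y|² dγ(x, y)` of a plan. -/
def cost (γ : Measure (X × X)) : ℝ≥0∞ := ∫⁻ p, ‖p.1 - p.2‖ₑ ^ 2 ∂γ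

/-- The squared Wasserstein distance `W₂²(μ, ν)`, the infimum of the cost over the couplings. -/
def W2Sq (μ ν : Measure X) : ℝ≥0∞ := ⨅ γ ∈ couplings μ ν, cost γ

/-- The optimal couplings `Γₒ(μ, ν)`: the couplings that realise the infimum in `W2Sq`. -/
def optimalCouplings (μ ν : Measure X) : Set (Measure (X × X)) :=
  {γ | γ ∈ couplings μ ν ∧ cost γ = W2Sq μ ν}

/-- The exponential map `exp^s (x, v) = x + s v`. -/
def expMap (s : ℝ) (p : X × X) : X := p.1 + s • p.2

/-- The difference quotient `(W₂²(exp^s_♯ Φ₀, μ₁) - W₂²(x_♯ Φ₀, μ₁)) / (2 s)`. -/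
def quotientMeasure (Φ₀ : Measure (X × X)) (μ₁ : Measure X) (s : ℝ) : ℝ :=
  ((W2Sq (Φ₀.map (expMap s)) μ₁).toReal - (W2Sq (Φ₀.map Prod.fst) μ₁).toReal) / (2 * s)

/-- The difference quotient
`(W₂²(exp^s_♯ Φ₀, exp^s_♯ Φ₁) - W₂²(x_♯ Φ₀, x_♯ Φ₁)) / (2 s)`. -/
def quotientField (Φ₀ Φ₁ : Measure (X × X)) (s : ℝ) : ℝ :=
  ((W2Sq (Φ₀.map (expMap s)) (Φ₁.map (expMap s))).toReal
    - (W2Sq (Φ₀.map Prod.fst) (Φ₁.map Prod.fst)).toReal) / (2 * s)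

/-- The pairing `[Φ₀, μ₁]_r`, the limit of `quotientMeasure Φ₀ μ₁ s` as `s ↓ 0`. -/
def pairingMeasure (Φ₀ : Measure (X × X)) (μ₁ : Measure X) : ℝ :=
  limUnder (𝓝[>] (0 : ℝ)) (quotientMeasure Φ₀ μ₁)

/-- The pairing `[Φ₀, Φ₁]_r`, the limit of `quotientField Φ₀ Φ₁ s` as `s ↓ 0`. -/
def pairingField (Φ₀ Φ₁ : Measure (X × X)) : ℝ :=
  limUnder (𝓝[>] (0 : ℝ)) (quotientField Φ₀ Φ₁)

/-- `Λ(Φ₀, μ₁)`: the couplings of `Φ₀` and `μ₁` whose `(x₀, x₁)`-marginal is optimal.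
A point of `TX × X` is `((x₀, v₀), x₁)`. -/
def lambdaMeasure (Φ₀ : Measure (X × X)) (μ₁ : Measure X) : Set (Measure ((X × X) × X)) :=
  {σ | σ ∈ couplings Φ₀ μ₁ ∧
    σ.map (fun q => (q.1.1, q.2)) ∈ optimalCouplings (Φ₀.map Prod.fst) μ₁}

/-- `Λ(Φ₀, Φ₁)`: the couplings of `Φ₀` and `Φ₁` whose `(x₀, x₁)`-marginal is optimal.
A point of `TX × TX` is `((x₀, v₀), (x₁, v₁))`. -/
def lambdaField (Φ₀ Φ₁ : Measure (X × X)) : Set (Measure ((X × X) × (X × X))) :=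
  {Θ | Θ ∈ couplings Φ₀ Φ₁ ∧
    Θ.map (fun q => (q.1.1, q.2.1)) ∈
      optimalCouplings (Φ₀.map Prod.fst) (Φ₁.map Prod.fst)}

/-- The integrand `⟨x₀ - x₁, v₀⟩` on `TX × X`. -/
def integrandMeasure (q : (X × X) × X) : ℝ := inner ℝ (q.1.1 - q.2) q.1.2

/-- The integrand `⟨x₀ - x₁, v₀ - v₁⟩` on `TX × TX`. -/
def integrandField (q : (X × X) × (X × X)) : ℝ :=
  inner ℝ (q.1.1 - q.2.1) (q.1.2 - q.2.2)

end

end WassersteinPairing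

/-! For every `s`, each coupling of `exp^s_♯ Φ₀` and `exp^s_♯ Φ₁` lifts to a coupling of `Φ₀` and
`Φ₁` (`exists_lift_coupling`). Hence `W₂²` at time `s` is the minimum, over one set of couplings `Θ`
independent of `s`, of `J(Θ) + 2sL(Θ) + s²M(Θ)`: expand the square and integrate
(`isLeast_W2Sq_map_expMap`). Here `L` is the integral in the theorem and `Λ` is the set of
minimisers of `J`.

That set is weakly compact even if `X` is infinite dimensional, since tightness comes from the fixed
marginals (`isCompact_couplings`). Fixed marginals also make quadratic tails uniformly small, so
`J`, `L`, `M` are weakly continuous on it (`continuousOn_integral_couplings`). An envelope argument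
of Danskin type (`tendsto_quotient_isLeast`) then gives the one-sided derivative as the minimum of
`L` over `Λ`.

The pairing with a measure is the case of a field with zero velocity. -/

namespace WassersteinPairing

/-! ### Envelope theorem on a compact set -/

/-- One-sided differentiability at `0` of the value function `s ↦ min_K (J + 2 s L + s² M)`. -/
theorem tendsto_quotient_isLeast {T : Type*} [TopologicalSpace T] {K : Set T} (hK : IsCompact K)
    {J L M : T → ℝ} (hJ : ContinuousOn J K) (hL : ContinuousOn L K)
    (hM : ∀ t ∈ K, 0 ≤ M t) {V : ℝ → ℝ}
    (hV : ∀ s, IsLeast ((fun t => J t + 2 * s * L t + s ^ 2 * M t) '' K) (V s)) :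
    ∃ t₀ ∈ K, J t₀ = V 0 ∧ (∀ t ∈ K, J t = V 0 → L t₀ ≤ L t) ∧
      Tendsto (fun s => (V s - V 0) / (2 * s)) (𝓝[>] (0 : ℝ)) (𝓝 (L t₀)) := by
  have hV0 : ∀ t ∈ K, V 0 ≤ J t := fun t ht => by simpa using (hV 0).2 ⟨t, ht, rfl⟩
  obtain ⟨t', ht', hJt'⟩ := (hV 0).1
  have hJt' : J t' = V 0 := by simpa using hJt'
  -- `V 0` is the minimum of `J`, so this sublevel set is the set of minimisers of `J`; `t₀`
  -- minimises `L` there.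
  obtain ⟨t₀, ⟨ht₀, hJt₀⟩, hmin⟩ :=
    (hJ.lowerSemicontinuousOn.isCompact_inter_preimage_Iic hK (V 0)).exists_isMinOn
      ⟨t', ht', hJt'.le⟩ (hL.mono Set.inter_subset_left)
  have hJ0 : J t₀ = V 0 := le_antisymm hJt₀ (hV0 t₀ ht₀)
  have hmin' : ∀ t ∈ K, J t = V 0 → L t₀ ≤ L t := fun t ht h => hmin ⟨ht, h.le⟩
  refine ⟨t₀, ht₀, hJ0, hmin', ?_⟩
  have hVle : ∀ s, V s ≤ V 0 + 2 * s * L t₀ + s ^ 2 * M t₀ := fun s => by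
    simpa [hJ0] using (hV s).2 ⟨t₀, ht₀, rfl⟩
  have hpos : ∀ᶠ s : ℝ in 𝓝[>] 0, 0 < s := self_mem_nhdsWithin
  refine tendsto_order.2 ⟨fun c hc => ?_, fun c hc => ?_⟩
  -- Lower bound. No minimiser of `J` has `L ≤ c < L t₀`, so by compactness `J` exceeds `V 0` by a
  -- fixed gap where `L ≤ c`. For small `s` the competitor `t₀` beats all such points, so minimisers
  -- at time `s` satisfy `L > c`.
  · obtain ⟨δ, hδ, hgap⟩ : ∃ δ > 0, ∀ t ∈ K, L t ≤ c → V 0 + δ ≤ J t := by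
      rcases (K ∩ L ⁻¹' Set.Iic c).eq_empty_or_nonempty with he | hne
      · exact ⟨1, one_pos, fun t ht h => (he.subset ⟨ht, h⟩).elim⟩
      · obtain ⟨t₁, ⟨ht₁, hLt₁⟩, h₁⟩ :=
          (hL.lowerSemicontinuousOn.isCompact_inter_preimage_Iic hK c).exists_isMinOn hne
            (hJ.mono Set.inter_subset_left)
        have hlt : V 0 < J t₁ := lt_of_le_of_ne (hV0 t₁ ht₁) fun h =>
          (hc.trans_le (hmin' t₁ ht₁ h.symm)).not_ge hLt₁
        refine ⟨J t₁ - V 0, sub_pos.2 hlt, fun t ht h => ?_⟩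
        have : J t₁ ≤ J t := h₁ ⟨ht, h⟩
        linarith
    obtain ⟨t₂, ht₂, h₂⟩ := hK.exists_isMinOn ⟨t₀, ht₀⟩ hL
    have hsmall : ∀ᶠ s : ℝ in 𝓝[>] 0, 2 * s * (L t₀ - L t₂) + s ^ 2 * M t₀ < δ := by
      have : Continuous fun s : ℝ => 2 * s * (L t₀ - L t₂) + s ^ 2 * M t₀ := by fun_prop
      exact ((this.tendsto' 0 0 (by simp)).mono_left nhdsWithin_le_nhds).eventually
        (eventually_lt_nhds hδ)
    filter_upwards [hpos, hsmall] with s hs hss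
    obtain ⟨t, ht, hVs⟩ := (hV s).1
    have hMt := mul_nonneg (sq_nonneg s) (hM t ht)
    have hLt : c < L t := by
      by_contra! h
      have h3 : L t₂ ≤ L t := h₂ ht
      have h4 := mul_le_mul_of_nonneg_left h3 hs.le
      have := hgap t ht h
      have := hVle s
      simp only at hVs
      nlinarith
    rw [lt_div_iff₀ (by positivity)]
    have := mul_lt_mul_of_pos_left hLt hs
    have := hV0 t ht
    simp only at hVs
    nlinarith
  -- Upper bound: `t₀` is a competitor at every `s`.
  · have hsmall : ∀ᶠ s : ℝ in 𝓝[>] 0, L t₀ + s * M t₀ / 2 < c := by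
      have : Continuous fun s : ℝ => L t₀ + s * M t₀ / 2 := by fun_prop
      exact ((this.tendsto' 0 (L t₀) (by simp)).mono_left nhdsWithin_le_nhds).eventually
        (eventually_lt_nhds hc)
    filter_upwards [hpos, hsmall] with s hs hss
    rw [div_lt_iff₀ (by positivity)]
    have := hVle s
    have := mul_lt_mul_of_pos_left hss hs
    nlinarith

/-! ### Lifting couplings along maps -/

section Couplings

variable {E F : Type*} [MeasurableSpace E] [MeasurableSpace F]

theorem prod_mem_couplings (Φ : Measure E) (Ψ : Measure F) [IsProbabilityMeasure Φ]
    [IsProbabilityMeasure Ψ] : Φ.prod Ψ ∈ couplings Φ Ψ :=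
  ⟨inferInstance, by simp, by simp⟩

theorem map_mem_couplings {E' F' : Type*} [MeasurableSpace E'] [MeasurableSpace F']
    {Φ : Measure E} {Ψ : Measure F} {Θ : Measure (E × F)} (hΘ : Θ ∈ couplings Φ Ψ)
    {f : E → E'} {g : F → F'} (hf : Measurable f) (hg : Measurable g) :
    Θ.map (Prod.map f g) ∈ couplings (Φ.map f) (Ψ.map g) := by
  obtain ⟨h, rfl, rfl⟩ := hΘ
  refine ⟨Measure.isProbabilityMeasure_map (by fun_prop), ?_, ?_⟩
  all_goals rw [Measure.map_map (by fun_prop) (by fun_prop),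
    Measure.map_map (by fun_prop) (by fun_prop)]; rfl

theorem swap_mem_couplings {Φ : Measure E} {Ψ : Measure F} {Θ : Measure (E × F)}
    (hΘ : Θ ∈ couplings Φ Ψ) : Θ.map Prod.swap ∈ couplings Ψ Φ := by
  obtain ⟨h, rfl, rfl⟩ := hΘ
  refine ⟨Measure.isProbabilityMeasure_map (by fun_prop), ?_, ?_⟩
  all_goals rw [Measure.map_map (by fun_prop) (by fun_prop)]; rfl

/-- A coupling of `f_♯ Φ` and `Ψ` lifts to a coupling of `Φ` and `Ψ`. -/
theorem exists_lift_coupling_left {Y : Type*} [MeasurableSpace Y] [StandardBorelSpace F]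
    [Nonempty F] {Φ : Measure E} [IsProbabilityMeasure Φ] {Ψ : Measure F} {f : E → Y}
    (hf : Measurable f) {γ : Measure (Y × F)} (hγ : γ ∈ couplings (Φ.map f) Ψ) :
    ∃ Θ ∈ couplings Φ Ψ, Θ.map (Prod.map f id) = γ := by
  obtain ⟨hp, h1, h2⟩ := hγ
  -- Disintegrate `γ` over its first marginal and draw the second coordinate from `κ (f p)`, with
  -- `p` distributed by `Φ`.
  set κ := ProbabilityTheory.condDistrib Prod.snd Prod.fst γ
  have hmap : (Φ.compProd (κ.comap f hf)).map (Prod.map f id) = γ := by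
    have h : (γ.map Prod.fst).compProd κ = γ := by
      simpa using ProbabilityTheory.compProd_map_condDistrib (X := Prod.fst)
        (measurable_snd (α := Y) (β := F)).aemeasurable (μ := γ)
    rw [h1] at h
    conv_rhs => rw [← h]
    ext s hs
    rw [Measure.map_apply (by fun_prop) hs, Measure.compProd_apply (by measurability),
      Measure.compProd_apply hs,
      lintegral_map (ProbabilityTheory.Kernel.measurable_kernel_prodMk_left hs) hf]
    rfl
  refine ⟨Φ.compProd (κ.comap f hf), ⟨inferInstance, Measure.fst_compProd _ _, ?_⟩, hmap⟩
  rw [← h2, ← hmap, Measure.map_map (by fun_prop) (by fun_prop)]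
  rfl

/-- A coupling of `f_♯ Φ` and `g_♯ Ψ` lifts to a coupling of `Φ` and `Ψ`. -/
theorem exists_lift_coupling {Y Z : Type*} [MeasurableSpace Y] [MeasurableSpace Z]
    [StandardBorelSpace E] [Nonempty E] [StandardBorelSpace Z] [Nonempty Z]
    {Φ : Measure E} [IsProbabilityMeasure Φ] {Ψ : Measure F} [IsProbabilityMeasure Ψ]
    {f : E → Y} {g : F → Z} (hf : Measurable f) (hg : Measurable g) {γ : Measure (Y × Z)}
    (hγ : γ ∈ couplings (Φ.map f) (Ψ.map g)) :
    ∃ Θ ∈ couplings Φ Ψ, Θ.map (Prod.map f g) = γ := by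
  obtain ⟨Θ₁, h₁, rfl⟩ := exists_lift_coupling_left hf hγ
  obtain ⟨Θ₂, h₂, h⟩ := exists_lift_coupling_left hg (swap_mem_couplings h₁)
  refine ⟨Θ₂.map Prod.swap, swap_mem_couplings h₂, ?_⟩
  have h' : Θ₁ = (Θ₂.map (Prod.map g id)).map Prod.swap := by
    rw [h, Measure.map_map (by fun_prop) (by fun_prop)]
    simp
  rw [h', Measure.map_map (by fun_prop) (by fun_prop), Measure.map_map (by fun_prop) (by fun_prop),
    Measure.map_map (by fun_prop) (by fun_prop)]
  rfl

end Couplings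

/-! ### Weak compactness and continuity on couplings -/

section Compactness

variable {E F : Type*} [MeasurableSpace E] [MeasurableSpace F]

theorem integrable_fst_of_mem_couplings {Φ : Measure E} {Ψ : Measure F} {Θ : Measure (E × F)}
    (hΘ : Θ ∈ couplings Φ Ψ) {a : E → ℝ} (ha : Integrable a Φ) :
    Integrable (fun q => a q.1) Θ := by
  obtain ⟨_, rfl, _⟩ := hΘ
  exact ha.comp_measurable measurable_fst

theorem integrable_snd_of_mem_couplings {Φ : Measure E} {Ψ : Measure F} {Θ : Measure (E × F)}
    (hΘ : Θ ∈ couplings Φ Ψ) {b : F → ℝ} (hb : Integrable b Ψ) :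
    Integrable (fun q => b q.2) Θ := by
  obtain ⟨_, _, rfl⟩ := hΘ
  exact hb.comp_measurable measurable_snd

theorem integral_fst_of_mem_couplings {Φ : Measure E} {Ψ : Measure F} {Θ : Measure (E × F)}
    (hΘ : Θ ∈ couplings Φ Ψ) {a : E → ℝ} (ha : Integrable a Φ) :
    ∫ q, a q.1 ∂Θ = ∫ p, a p ∂Φ := by
  obtain ⟨_, rfl, _⟩ := hΘ
  exact (integral_map measurable_fst.aemeasurable ha.aestronglyMeasurable).symm

theorem integral_snd_of_mem_couplings {Φ : Measure E} {Ψ : Measure F} {Θ : Measure (E × F)}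
    (hΘ : Θ ∈ couplings Φ Ψ) {b : F → ℝ} (hb : Integrable b Ψ) :
    ∫ q, b q.2 ∂Θ = ∫ p, b p ∂Ψ := by
  obtain ⟨_, _, rfl⟩ := hΘ
  exact (integral_map measurable_snd.aemeasurable hb.aestronglyMeasurable).symm

/-- Dominated convergence. These tails depend on a marginal alone, so they control truncation errors
uniformly over couplings. -/
theorem tendsto_integral_posPart_sub {Φ : Measure E} {a : E → ℝ}
    (ha : Integrable a Φ) :
    Tendsto (fun n : ℕ => ∫ p, max (a p - n) 0 ∂Φ) atTop (𝓝 0) := by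
  have h := tendsto_integral_of_dominated_convergence (μ := Φ)
    (F := fun (n : ℕ) p => max (a p - n) 0) (f := fun _ => 0) (fun p => |a p|)
    (fun n => (ha.aestronglyMeasurable.sub aestronglyMeasurable_const).sup
      aestronglyMeasurable_const) ha.abs
    (fun n => .of_forall fun p => by
      rw [Real.norm_of_nonneg (le_max_right _ _)]
      have : (0 : ℝ) ≤ n := n.cast_nonneg
      exact max_le (by linarith [le_abs_self (a p)]) (abs_nonneg _))
    (.of_forall fun p => by
      obtain ⟨N, hN⟩ := exists_nat_ge (a p)
      refine tendsto_const_nhds.congr' ?_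
      filter_upwards [eventually_ge_atTop N] with n hn
      have : (N : ℝ) ≤ n := by exact_mod_cast hn
      exact (max_eq_right (by linarith)).symm)
  simpa using h

theorem integrable_of_mem_couplings {Φ : Measure E} {Ψ : Measure F} {f : E × F → ℝ}
    (hf : Measurable f) {a : E → ℝ} {b : F → ℝ} (ha : Integrable a Φ) (hb : Integrable b Ψ)
    (hfab : ∀ q, |f q| ≤ a q.1 + b q.2) {Θ : Measure (E × F)} (hΘ : Θ ∈ couplings Φ Ψ) :
    Integrable f Θ :=
  ((integrable_fst_of_mem_couplings hΘ ha).add (integrable_snd_of_mem_couplings hΘ hb)).mono'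
    hf.aestronglyMeasurable (.of_forall hfab)

variable [TopologicalSpace E] [TopologicalSpace F] [BorelSpace E] [BorelSpace F]

/-- The couplings of two probability measures on Polish spaces are weakly compact. -/
theorem isCompact_couplings [PolishSpace E] [PolishSpace F] (Φ : Measure E) (Ψ : Measure F) [IsProbabilityMeasure Φ]
    [IsProbabilityMeasure Ψ] :
    IsCompact {Θ : ProbabilityMeasure (E × F) | (Θ : Measure (E × F)) ∈ couplings Φ Ψ} := by
  let := TopologicalSpace.upgradeIsCompletelyMetrizable E
  let := TopologicalSpace.upgradeIsCompletelyMetrizable F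
  set S := {Θ : ProbabilityMeasure (E × F) | (Θ : Measure (E × F)) ∈ couplings Φ Ψ}
  have hclosed : IsClosed S := by
    have : S = {Θ : ProbabilityMeasure (E × F) |
          Θ.map measurable_fst.aemeasurable = (⟨Φ, inferInstance⟩ : ProbabilityMeasure E)} ∩
        {Θ : ProbabilityMeasure (E × F) |
          Θ.map measurable_snd.aemeasurable = (⟨Ψ, inferInstance⟩ : ProbabilityMeasure F)} := by
      ext Θ
      exact ⟨fun h => ⟨Subtype.ext h.2.1, Subtype.ext h.2.2⟩,
        fun h => ⟨Θ.2, congrArg Subtype.val h.1, congrArg Subtype.val h.2⟩⟩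
    rw [this]
    exact (isClosed_eq (ProbabilityMeasure.continuous_map continuous_fst) continuous_const).inter
      (isClosed_eq (ProbabilityMeasure.continuous_map continuous_snd) continuous_const)
  rw [← hclosed.closure_eq]
  -- Prokhorov: each family of marginals lies in a singleton, which is tight on a Polish space.
  refine isCompact_closure_of_isTightMeasureSet (IsTightMeasureSet.prodMk ?_ ?_)
  · refine (isTightMeasureSet_singleton (μ := Φ)).subset ?_
    rintro _ ⟨_, ⟨Θ, hΘ, rfl⟩, rfl⟩
    exact hΘ.2.1
  · refine (isTightMeasureSet_singleton (μ := Ψ)).subset ?_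
    rintro _ ⟨_, ⟨Θ, hΘ, rfl⟩, rfl⟩
    exact hΘ.2.2

/-- On the couplings of `Φ` and `Ψ`, integration of a continuous function dominated by
`a ⊕ b` with `a ∈ L¹(Φ)` and `b ∈ L¹(Ψ)` is weakly continuous. -/
theorem continuousOn_integral_couplings [SecondCountableTopology F] {Φ : Measure E}
    {Ψ : Measure F} {f : E × F → ℝ}
    (hf : Continuous f) {a : E → ℝ} {b : F → ℝ} (ha : Integrable a Φ) (hb : Integrable b Ψ)
    (hfab : ∀ q, |f q| ≤ a q.1 + b q.2) :
    ContinuousOn (fun Θ : ProbabilityMeasure (E × F) => ∫ q, f q ∂(Θ : Measure (E × F)))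
      {Θ | (Θ : Measure (E × F)) ∈ couplings Φ Ψ} := by
  -- Truncating at `2n` splits the excess between the marginals: `a + b - 2n ≤ (a - n)⁺ + (b - n)⁺`.
  let g : ℕ → BoundedContinuousFunction (E × F) ℝ := fun n =>
    BoundedContinuousFunction.ofNormedAddCommGroup (fun q => max (-(2 * n : ℝ)) (min (f q) (2 * n)))
      (by fun_prop) (2 * n) (fun q => by
        have : (0 : ℝ) ≤ 2 * n := by positivity
        rw [Real.norm_eq_abs, abs_le]
        exact ⟨le_max_left _ _, max_le (by linarith) (min_le_right _ _)⟩)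
  have hg : ∀ n q, g n q = max (-(2 * n : ℝ)) (min (f q) (2 * n)) := fun _ _ => rfl
  have hgf : ∀ n q, |f q - g n q| ≤ max (a q.1 - n) 0 + max (b q.2 - n) 0 := fun n q => by
    have h1 := hfab q
    have h2 := le_max_left (a q.1 - n) 0
    have h3 := le_max_right (a q.1 - n) 0
    have h4 := le_max_left (b q.2 - n) 0
    have h5 := le_max_right (b q.2 - n) 0
    have h6 : (0 : ℝ) ≤ n := n.cast_nonneg
    rw [abs_le] at h1 ⊢
    rw [hg]
    rcases le_total (f q) (2 * n) with h | h
    · rw [min_eq_left h]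
      rcases le_total (-(2 * n : ℝ)) (f q) with h' | h'
      · rw [max_eq_right h']; constructor <;> linarith
      · rw [max_eq_left h']; constructor <;> linarith
    · rw [min_eq_right h, max_eq_right (by linarith : -(2 * n : ℝ) ≤ 2 * n)]; constructor <;> linarith
  have hunif : TendstoUniformlyOn
      (fun (n : ℕ) (Θ : ProbabilityMeasure (E × F)) => ∫ q, g n q ∂(Θ : Measure (E × F)))
      (fun Θ => ∫ q, f q ∂(Θ : Measure (E × F))) atTop
      {Θ | (Θ : Measure (E × F)) ∈ couplings Φ Ψ} := by
    rw [Metric.tendstoUniformlyOn_iff]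
    intro ε hε
    have hlim := (tendsto_integral_posPart_sub ha).add (tendsto_integral_posPart_sub hb)
    rw [add_zero] at hlim
    filter_upwards [hlim.eventually (eventually_lt_nhds hε)] with n hn Θ hΘ
    refine lt_of_le_of_lt ?_ hn
    have hΦ : IsProbabilityMeasure Φ := by
      rw [← hΘ.2.1]; exact Measure.isProbabilityMeasure_map measurable_fst.aemeasurable
    have hΨ : IsProbabilityMeasure Ψ := by
      rw [← hΘ.2.2]; exact Measure.isProbabilityMeasure_map measurable_snd.aemeasurable
    have ha' : Integrable (fun p => max (a p - n) 0) Φ :=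
      (ha.sub (integrable_const _)).sup (integrable_const _)
    have hb' : Integrable (fun p => max (b p - n) 0) Ψ :=
      (hb.sub (integrable_const _)).sup (integrable_const _)
    rw [Real.dist_eq, ← integral_sub (integrable_of_mem_couplings hf.measurable ha hb hfab hΘ)
      ((g n).integrable _), ← integral_fst_of_mem_couplings hΘ ha',
      ← integral_snd_of_mem_couplings hΘ hb',
      ← integral_add (integrable_fst_of_mem_couplings hΘ ha')
        (integrable_snd_of_mem_couplings hΘ hb')]
    exact norm_integral_le_of_norm_le (f := fun q => f q - g n q) ((integrable_fst_of_mem_couplings hΘ ha').add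
        (integrable_snd_of_mem_couplings hΘ hb')) (.of_forall (hgf n))
  exact hunif.continuousOn (.of_forall fun n =>
    (ProbabilityMeasure.continuous_integral_boundedContinuousFunction (g n)).continuousOn)

end Compactness

/-! ### Second moments and zero-velocity fields -/

section Moments

variable {X : Type*} [NormedAddCommGroup X] [MeasurableSpace X] [BorelSpace X]
  [SecondCountableTopology X]

theorem integrable_of_mem_P2T {Φ : Measure (X × X)} (hΦ : Φ ∈ P2T X) :
    Integrable (fun p => 2 * (‖p.1‖ ^ 2 + ‖p.2‖ ^ 2)) Φ := by
  refine Integrable.const_mul ⟨by fun_prop, ?_⟩ 2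
  refine lt_of_eq_of_lt (lintegral_congr fun p => ?_) hΦ.2
  rw [Real.enorm_of_nonneg (by positivity), ENNReal.ofReal_add (by positivity) (by positivity),
    ENNReal.ofReal_pow (norm_nonneg _), ENNReal.ofReal_pow (norm_nonneg _), ofReal_norm,
    ofReal_norm]

/-- A measure regarded as a field of zero velocities. -/
theorem map_zero_velocity_mem_P2T {μ : Measure X} (hμ : μ ∈ P2 X) :
    μ.map (fun x => (x, (0 : X))) ∈ P2T X := by
  have := hμ.1
  refine ⟨Measure.isProbabilityMeasure_map (by fun_prop), ?_⟩
  rw [lintegral_map (by fun_prop) (by fun_prop)]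
  simpa using hμ.2

/-- The second velocity vanishes almost everywhere, so forgetting it and putting zero back loses
nothing. -/
theorem map_zero_velocity_map_fst {Φ : Measure (X × X)} {μ : Measure X}
    {Θ : Measure ((X × X) × (X × X))}
    (hΘ : Θ ∈ couplings Φ (μ.map (fun x => (x, (0 : X))))) :
    (Θ.map (Prod.map id Prod.fst)).map (Prod.map id (fun x => (x, (0 : X)))) = Θ := by
  have hae : ∀ᵐ q ∂Θ, q.2.2 = 0 := by
    refine ae_of_ae_map (f := Prod.snd) (p := fun p : X × X => p.2 = 0) (by fun_prop) ?_
    rw [hΘ.2.2, ae_map_iff (by fun_prop) (measurableSet_eq_fun measurable_snd measurable_const)]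
    simp
  rw [Measure.map_map (by fun_prop) (by fun_prop)]
  conv_rhs => rw [← Measure.map_id (μ := Θ)]
  refine Measure.map_congr (hae.mono fun q hq => ?_)
  ext <;> simp [hq]

end Moments

/-! ### Expansion of the cost and the two pairings -/

section Pairing

variable {X : Type*} [NormedAddCommGroup X] [InnerProductSpace ℝ X]

theorem norm_sub_sq_le (a b : X) : ‖a - b‖ ^ 2 ≤ 2 * (‖a‖ ^ 2 + ‖b‖ ^ 2) := by
  have := parallelogram_law_with_norm ℝ a b
  nlinarith [sq_nonneg ‖a + b‖]

theorem abs_base_sq_le (q : (X × X) × (X × X)) :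
    |‖q.1.1 - q.2.1‖ ^ 2| ≤
      2 * (‖q.1.1‖ ^ 2 + ‖q.1.2‖ ^ 2) + 2 * (‖q.2.1‖ ^ 2 + ‖q.2.2‖ ^ 2) := by
  rw [abs_of_nonneg (by positivity)]
  linarith [norm_sub_sq_le q.1.1 q.2.1, sq_nonneg ‖q.1.2‖, sq_nonneg ‖q.2.2‖]

theorem abs_velocity_sq_le (q : (X × X) × (X × X)) :
    |‖q.1.2 - q.2.2‖ ^ 2| ≤
      2 * (‖q.1.1‖ ^ 2 + ‖q.1.2‖ ^ 2) + 2 * (‖q.2.1‖ ^ 2 + ‖q.2.2‖ ^ 2) := by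
  rw [abs_of_nonneg (by positivity)]
  linarith [norm_sub_sq_le q.1.2 q.2.2, sq_nonneg ‖q.1.1‖, sq_nonneg ‖q.2.1‖]

theorem abs_integrandField_le (q : (X × X) × (X × X)) :
    |integrandField q| ≤
      2 * (‖q.1.1‖ ^ 2 + ‖q.1.2‖ ^ 2) + 2 * (‖q.2.1‖ ^ 2 + ‖q.2.2‖ ^ 2) := by
  have h := abs_real_inner_le_norm (q.1.1 - q.2.1) (q.1.2 - q.2.2)
  have h' := two_mul_le_add_sq ‖q.1.1 - q.2.1‖ ‖q.1.2 - q.2.2‖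
  rw [integrandField]
  nlinarith [norm_sub_sq_le q.1.1 q.2.1, norm_sub_sq_le q.1.2 q.2.2, sq_nonneg ‖q.1.1‖,
    sq_nonneg ‖q.2.1‖, sq_nonneg ‖q.1.2‖, sq_nonneg ‖q.2.2‖]

theorem norm_expMap_sub_sq (s : ℝ) (q : (X × X) × (X × X)) :
    ‖expMap s q.1 - expMap s q.2‖ ^ 2 =
      ‖q.1.1 - q.2.1‖ ^ 2 + 2 * s * integrandField q + s ^ 2 * ‖q.1.2 - q.2.2‖ ^ 2 := by
  have : expMap s q.1 - expMap s q.2 = (q.1.1 - q.2.1) + s • (q.1.2 - q.2.2) := by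
    simp only [expMap, smul_sub]; abel
  rw [this, norm_add_sq_real, inner_smul_right, norm_smul, mul_pow, Real.norm_eq_abs, sq_abs,
    integrandField]
  ring

theorem expMap_zero : expMap (X := X) 0 = Prod.fst := by
  ext p; simp [expMap]

theorem continuous_expMap (s : ℝ) : Continuous (expMap (X := X) s) := by
  unfold expMap; fun_prop

theorem continuous_integrandField : Continuous (integrandField (X := X)) := by
  unfold integrandField; fun_prop

variable [MeasurableSpace X] [BorelSpace X] [SecondCountableTopology X]

theorem integral_norm_expMap_sub_sq {Φ₀ Φ₁ : Measure (X × X)} (hΦ₀ : Φ₀ ∈ P2T X)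
    (hΦ₁ : Φ₁ ∈ P2T X) {Θ : Measure ((X × X) × (X × X))} (hΘ : Θ ∈ couplings Φ₀ Φ₁) (s : ℝ) :
    Integrable (fun q => ‖expMap s q.1 - expMap s q.2‖ ^ 2) Θ ∧
    ∫ q, ‖expMap s q.1 - expMap s q.2‖ ^ 2 ∂Θ =
      ∫ q, ‖q.1.1 - q.2.1‖ ^ 2 ∂Θ + 2 * s * ∫ q, integrandField q ∂Θ
        + s ^ 2 * ∫ q, ‖q.1.2 - q.2.2‖ ^ 2 ∂Θ := by
  have ha := integrable_of_mem_P2T hΦ₀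
  have hb := integrable_of_mem_P2T hΦ₁
  have hJ := integrable_of_mem_couplings (by fun_prop) ha hb abs_base_sq_le hΘ
  have hL := (integrable_of_mem_couplings continuous_integrandField.measurable ha hb
    abs_integrandField_le hΘ).const_mul (2 * s)
  have hM := (integrable_of_mem_couplings (by fun_prop) ha hb abs_velocity_sq_le hΘ).const_mul
    (s ^ 2)
  have hJL : Integrable (fun q => ‖q.1.1 - q.2.1‖ ^ 2 + 2 * s * integrandField q) Θ := hJ.add hL
  simp_rw [norm_expMap_sub_sq]
  exact ⟨hJL.add hM, by
    rw [integral_add hJL hM, integral_add hJ hL, integral_const_mul, integral_const_mul]⟩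

theorem cost_map_expMap {Φ₀ Φ₁ : Measure (X × X)} (hΦ₀ : Φ₀ ∈ P2T X) (hΦ₁ : Φ₁ ∈ P2T X)
    {Θ : Measure ((X × X) × (X × X))} (hΘ : Θ ∈ couplings Φ₀ Φ₁) (s : ℝ) :
    cost (Θ.map (Prod.map (expMap s) (expMap s))) = ENNReal.ofReal
      (∫ q, ‖q.1.1 - q.2.1‖ ^ 2 ∂Θ + 2 * s * ∫ q, integrandField q ∂Θ
        + s ^ 2 * ∫ q, ‖q.1.2 - q.2.2‖ ^ 2 ∂Θ) := by
  obtain ⟨hint, heq⟩ := integral_norm_expMap_sub_sq hΦ₀ hΦ₁ hΘ s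
  have he := (continuous_expMap (X := X) s).measurable
  rw [cost, lintegral_map (by fun_prop) (by fun_prop), ← heq,
    ofReal_integral_eq_lintegral_ofReal hint (.of_forall fun q => sq_nonneg _)]
  refine lintegral_congr fun q => ?_
  rw [ENNReal.ofReal_pow (norm_nonneg _), ofReal_norm]
  rfl

theorem map_expMap_zero_velocity (μ : Measure X) (s : ℝ) :
    (μ.map (fun x => (x, (0 : X)))).map (expMap s) = μ := by
  rw [Measure.map_map (continuous_expMap s).measurable (by fun_prop)]
  convert Measure.map_id
  ext x
  simp [expMap]

theorem quotientMeasure_eq_quotientField (Φ : Measure (X × X)) (μ : Measure X) :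
    quotientMeasure Φ μ = quotientField Φ (μ.map (fun x => (x, (0 : X)))) := by
  ext s
  have h := map_expMap_zero_velocity μ 0
  rw [expMap_zero] at h
  rw [quotientMeasure, quotientField, map_expMap_zero_velocity, h]

theorem map_mem_lambdaField {Φ : Measure (X × X)} {μ : Measure X} {σ : Measure ((X × X) × X)}
    (hσ : σ ∈ lambdaMeasure Φ μ) :
    σ.map (Prod.map id (fun x => (x, (0 : X)))) ∈
      lambdaField Φ (μ.map (fun x => (x, (0 : X)))) := by
  have h := map_expMap_zero_velocity μ 0
  rw [expMap_zero] at h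
  refine ⟨?_, ?_⟩
  · simpa using map_mem_couplings hσ.1 measurable_id
      (show Measurable fun x : X => (x, (0 : X)) by fun_prop)
  rw [h, Measure.map_map (by fun_prop) (by fun_prop)]
  exact hσ.2

theorem map_mem_lambdaMeasure {Φ : Measure (X × X)} {μ : Measure X}
    {Θ : Measure ((X × X) × (X × X))}
    (hΘ : Θ ∈ lambdaField Φ (μ.map (fun x => (x, (0 : X))))) :
    Θ.map (Prod.map id Prod.fst) ∈ lambdaMeasure Φ μ := by
  have h := map_expMap_zero_velocity μ 0
  rw [expMap_zero] at h
  refine ⟨?_, ?_⟩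
  · simpa [h] using map_mem_couplings hΘ.1 measurable_id (measurable_fst (α := X) (β := X))
  rw [Measure.map_map (by fun_prop) (by fun_prop), ← h]
  exact hΘ.2

theorem integral_map_zero_velocity (σ : Measure ((X × X) × X)) :
    ∫ q, integrandField q ∂(σ.map (Prod.map id (fun x => (x, (0 : X))))) =
      ∫ q, integrandMeasure q ∂σ := by
  rw [integral_map (by fun_prop) continuous_integrandField.measurable.aestronglyMeasurable]
  simp [integrandField, integrandMeasure]

variable [CompleteSpace X]

theorem isLeast_W2Sq_map_expMap {Φ₀ Φ₁ : Measure (X × X)} (hΦ₀ : Φ₀ ∈ P2T X)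
    (hΦ₁ : Φ₁ ∈ P2T X) (s : ℝ) :
    W2Sq (Φ₀.map (expMap s)) (Φ₁.map (expMap s)) ≠ ∞ ∧
    IsLeast ((fun Θ : ProbabilityMeasure ((X × X) × (X × X)) =>
        ∫ q, ‖q.1.1 - q.2.1‖ ^ 2 ∂(Θ : Measure ((X × X) × (X × X)))
          + 2 * s * ∫ q, integrandField q ∂(Θ : Measure ((X × X) × (X × X)))
          + s ^ 2 * ∫ q, ‖q.1.2 - q.2.2‖ ^ 2 ∂(Θ : Measure ((X × X) × (X × X)))) ''
        {Θ | (Θ : Measure ((X × X) × (X × X))) ∈ couplings Φ₀ Φ₁})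
      (W2Sq (Φ₀.map (expMap s)) (Φ₁.map (expMap s))).toReal := by
  have := hΦ₀.1
  have := hΦ₁.1
  have ha := integrable_of_mem_P2T hΦ₀
  have hb := integrable_of_mem_P2T hΦ₁
  have he := (continuous_expMap (X := X) s).measurable
  have hJ := continuousOn_integral_couplings (by fun_prop) ha hb abs_base_sq_le
  have hL := continuousOn_integral_couplings continuous_integrandField ha hb abs_integrandField_le
  have hM := continuousOn_integral_couplings (by fun_prop) ha hb abs_velocity_sq_le
  obtain ⟨Θ, hΘ, hmin⟩ := (isCompact_couplings Φ₀ Φ₁).exists_isMinOn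
    ⟨⟨Φ₀.prod Φ₁, inferInstance⟩, prod_mem_couplings Φ₀ Φ₁⟩
    ((hJ.add (hL.const_mul (2 * s))).add (hM.const_mul (s ^ 2)))
  have hW : W2Sq (Φ₀.map (expMap s)) (Φ₁.map (expMap s)) =
      cost ((Θ : Measure ((X × X) × (X × X))).map (Prod.map (expMap s) (expMap s))) := by
    -- Pushing `Θ` forward gives one inequality; lifting an arbitrary `γ` and using minimality of
    -- `Θ` gives the other.
    refine le_antisymm (iInf₂_le _ (map_mem_couplings hΘ he he)) (le_iInf₂ fun γ hγ => ?_)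
    obtain ⟨Θ', hΘ', rfl⟩ := exists_lift_coupling he he hγ
    rw [cost_map_expMap hΦ₀ hΦ₁ hΘ, cost_map_expMap hΦ₀ hΦ₁ hΘ']
    have := hΘ'.1
    exact ENNReal.ofReal_le_ofReal (hmin (a := ⟨Θ', hΘ'.1⟩) hΘ')
  have hnn : 0 ≤ ∫ q, ‖q.1.1 - q.2.1‖ ^ 2 ∂(Θ : Measure ((X × X) × (X × X)))
      + 2 * s * ∫ q, integrandField q ∂(Θ : Measure ((X × X) × (X × X)))
      + s ^ 2 * ∫ q, ‖q.1.2 - q.2.2‖ ^ 2 ∂(Θ : Measure ((X × X) × (X × X))) := by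
    rw [← (integral_norm_expMap_sub_sq hΦ₀ hΦ₁ hΘ s).2]
    exact integral_nonneg fun q => sq_nonneg _
  rw [hW, cost_map_expMap hΦ₀ hΦ₁ hΘ]
  refine ⟨ENNReal.ofReal_ne_top, ?_⟩
  rw [ENNReal.toReal_ofReal hnn]
  exact ⟨⟨Θ, hΘ, rfl⟩, by rintro _ ⟨Θ', hΘ', rfl⟩; exact hmin hΘ'⟩

/-- At `s = 0` the transport cost is `J`, so `Λ` is where `J` attains its minimum. Finiteness of
`W₂²` makes `toReal` faithful here. -/
theorem mem_lambdaField_iff {Φ₀ Φ₁ : Measure (X × X)} (hΦ₀ : Φ₀ ∈ P2T X) (hΦ₁ : Φ₁ ∈ P2T X)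
    {Θ : Measure ((X × X) × (X × X))} :
    Θ ∈ lambdaField Φ₀ Φ₁ ↔ Θ ∈ couplings Φ₀ Φ₁ ∧ ∫ q, ‖q.1.1 - q.2.1‖ ^ 2 ∂Θ =
      (W2Sq (Φ₀.map (expMap 0)) (Φ₁.map (expMap 0))).toReal := by
  refine and_congr_right fun hΘ => ?_
  have hfin := (isLeast_W2Sq_map_expMap hΦ₀ hΦ₁ 0).1
  have hc := cost_map_expMap hΦ₀ hΦ₁ hΘ 0
  rw [expMap_zero] at hfin hc ⊢
  simp only [mul_zero, zero_mul, add_zero, ne_eq, OfNat.ofNat_ne_zero, not_false_eq_true,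
    zero_pow] at hc
  have hmem := map_mem_couplings hΘ (measurable_fst (α := X) (β := X))
    (measurable_fst (α := X) (β := X))
  have hiff : Θ.map (fun q => (q.1.1, q.2.1)) ∈
      optimalCouplings (Φ₀.map Prod.fst) (Φ₁.map Prod.fst) ↔
      cost (Θ.map (Prod.map Prod.fst Prod.fst)) = W2Sq (Φ₀.map Prod.fst) (Φ₁.map Prod.fst) :=
    ⟨fun h => h.2, fun h => ⟨hmem, h⟩⟩
  rw [hiff, hc, ← ENNReal.ofReal_toReal hfin, ENNReal.ofReal_eq_ofReal_iff
    (integral_nonneg fun q => sq_nonneg _) ENNReal.toReal_nonneg, ENNReal.toReal_ofReal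
    ENNReal.toReal_nonneg]

/-- The limit defining `[Φ₀, Φ₁]_r` exists and is the least value of the integral over
`Λ(Φ₀, Φ₁)`. -/
theorem pairingField_isLeast {Φ₀ Φ₁ : Measure (X × X)} (hΦ₀ : Φ₀ ∈ P2T X) (hΦ₁ : Φ₁ ∈ P2T X) :
    Tendsto (quotientField Φ₀ Φ₁) (𝓝[>] (0 : ℝ)) (𝓝 (pairingField Φ₀ Φ₁)) ∧
      (∀ Θ ∈ lambdaField Φ₀ Φ₁, Integrable integrandField Θ) ∧
      IsLeast {r : ℝ | ∃ Θ ∈ lambdaField Φ₀ Φ₁, r = ∫ q, integrandField q ∂Θ}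
        (pairingField Φ₀ Φ₁) := by
  have := hΦ₀.1
  have := hΦ₁.1
  have ha := integrable_of_mem_P2T hΦ₀
  have hb := integrable_of_mem_P2T hΦ₁
  obtain ⟨Θ, hΘ, hJ, hmin, hlim⟩ := tendsto_quotient_isLeast (isCompact_couplings Φ₀ Φ₁)
    (continuousOn_integral_couplings (by fun_prop) ha hb abs_base_sq_le)
    (continuousOn_integral_couplings continuous_integrandField ha hb abs_integrandField_le)
    (fun _ _ => integral_nonneg fun q => sq_nonneg _)
    (fun s => (isLeast_W2Sq_map_expMap hΦ₀ hΦ₁ s).2)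
  have hquot : quotientField Φ₀ Φ₁ = fun s =>
      ((W2Sq (Φ₀.map (expMap s)) (Φ₁.map (expMap s))).toReal -
        (W2Sq (Φ₀.map (expMap 0)) (Φ₁.map (expMap 0))).toReal) / (2 * s) := by
    ext s; rw [quotientField, expMap_zero]
  rw [← hquot] at hlim
  have hpair : pairingField Φ₀ Φ₁ = _ := hlim.limUnder_eq
  rw [hpair]
  refine ⟨hlim, fun Θ' hΘ' => integrable_of_mem_couplings continuous_integrandField.measurable
    ha hb abs_integrandField_le hΘ'.1,
    ⟨Θ, (mem_lambdaField_iff hΦ₀ hΦ₁).2 ⟨hΘ, hJ⟩, rfl⟩, ?_⟩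
  rintro _ ⟨Θ', hΘ', rfl⟩
  obtain ⟨hc, hJ'⟩ := (mem_lambdaField_iff hΦ₀ hΦ₁).1 hΘ'
  exact hmin ⟨Θ', hc.1⟩ hc hJ'

/-- The limit defining `[Φ₀, μ₁]_r` exists and is the least value of the integral over
`Λ(Φ₀, μ₁)`. -/
theorem pairingMeasure_isLeast {Φ : Measure (X × X)} {μ : Measure X} (hΦ : Φ ∈ P2T X)
    (hμ : μ ∈ P2 X) :
    Tendsto (quotientMeasure Φ μ) (𝓝[>] (0 : ℝ)) (𝓝 (pairingMeasure Φ μ)) ∧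
      (∀ σ ∈ lambdaMeasure Φ μ, Integrable integrandMeasure σ) ∧
      IsLeast {r : ℝ | ∃ σ ∈ lambdaMeasure Φ μ, r = ∫ q, integrandMeasure q ∂σ}
        (pairingMeasure Φ μ) := by
  obtain ⟨hlim, hint, hleast⟩ := pairingField_isLeast hΦ (map_zero_velocity_mem_P2T hμ)
  rw [pairingMeasure, quotientMeasure_eq_quotientField]
  refine ⟨hlim, fun σ hσ => ?_, ?_⟩
  · have := (hint _ (map_mem_lambdaField hσ)).comp_measurable (by fun_prop)
    have heq : integrandField ∘ Prod.map id (fun x => (x, (0 : X))) = integrandMeasure := by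
      ext q; simp [integrandField, integrandMeasure]
    rwa [heq] at this
  · change IsLeast _ (pairingField Φ (μ.map (fun x => (x, (0 : X)))))
    convert hleast using 1
    ext r
    constructor
    · rintro ⟨σ, hσ, rfl⟩
      exact ⟨_, map_mem_lambdaField hσ, (integral_map_zero_velocity σ).symm⟩
    · rintro ⟨Θ, hΘ, rfl⟩
      exact ⟨_, map_mem_lambdaMeasure hΘ, by
        rw [← integral_map_zero_velocity, map_zero_velocity_map_fst hΘ.1]⟩

end Pairing

end WassersteinPairing

theorem mainTheorem8 {X : Type*} [NormedAddCommGroup X] [InnerProductSpace ℝ X]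
    [CompleteSpace X] [TopologicalSpace.SeparableSpace X] [MeasurableSpace X] [BorelSpace X]
    (Φ₀ Φ₁ : Measure (X × X)) (μ₁ : Measure X)
    (hΦ₀ : Φ₀ ∈ WassersteinPairing.P2T X) (hΦ₁ : Φ₁ ∈ WassersteinPairing.P2T X)
    (hμ₁ : μ₁ ∈ WassersteinPairing.P2 X) :
    (Tendsto (WassersteinPairing.quotientMeasure Φ₀ μ₁) (𝓝[>] (0 : ℝ))
        (𝓝 (WassersteinPairing.pairingMeasure Φ₀ μ₁)) ∧
      (∀ σ ∈ WassersteinPairing.lambdaMeasure Φ₀ μ₁,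
        Integrable WassersteinPairing.integrandMeasure σ) ∧
      IsLeast {r : ℝ | ∃ σ ∈ WassersteinPairing.lambdaMeasure Φ₀ μ₁,
          r = ∫ q, WassersteinPairing.integrandMeasure q ∂σ}
        (WassersteinPairing.pairingMeasure Φ₀ μ₁)) ∧
    (Tendsto (WassersteinPairing.quotientField Φ₀ Φ₁) (𝓝[>] (0 : ℝ))
        (𝓝 (WassersteinPairing.pairingField Φ₀ Φ₁)) ∧
      (∀ Θ ∈ WassersteinPairing.lambdaField Φ₀ Φ₁,
        Integrable WassersteinPairing.integrandField Θ) ∧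
      IsLeast {r : ℝ | ∃ Θ ∈ WassersteinPairing.lambdaField Φ₀ Φ₁,
          r = ∫ q, WassersteinPairing.integrandField q ∂Θ}
        (WassersteinPairing.pairingField Φ₀ Φ₁)) := by
  have : SecondCountableTopology X := UniformSpace.secondCountable_of_separable X
  exact ⟨WassersteinPairing.pairingMeasure_isLeast hΦ₀ hμ₁,
    WassersteinPairing.pairingField_isLeast hΦ₀ hΦ₁⟩
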